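/- All logarithms are to base $2$, with the convention $\log 0 = 0$. Let $f:\{0,1\}^n\times\{0,1\}^n\to\{0,1\}$. A CDQS protocol (conditional disclosure of secrets with quantum resources) for a one-qubit secret $Q$ consists of a density matrix $\Psi_{LR}$, where $L$ (held by Alice) and $R$ (held by Bob) have $E$ qubits each, and of quantum channels $\mathcal N^x_{QL\to M_A}$ for $x\in\{0,1\}^n$ (Alice) and $\mathcal N^y_{R\to M_B}$ for $y\in\{0,1\}^n$ (Bob), where the messages $M_A$ and $M_B$ to the referee have $q_A$ and $q_B$ qubits. Put $\mathcal N^{x,y}_{Q\to M}(\cdot)=(\mathcal N^x\otimes\mathcal N^y)(\,\cdot\otimes\Psi_{LR})$ with $M=M_AM_B$. The protocol is $\epsilon$-correct for $f$ if for all $(x,y)$ with $f(x,y)=1$ there is a channel $\mathcal D^{x,y}_{M\to Q}$ with $\|\mathcal D^{x,y}\circ\mathcal N^{x,y}-\mathcal I_Q\|_\diamond\le\epsilon$. It is $\delta$-secure for $f$ if for all $(x,y)$ with $f(x,y)=0$ there is a density matrix $\sigma^{x,y}_M$ with $\|\sigma^{x,y}\operatorname{tr}_Q(\cdot)-\mathcal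 N^{x,y}\|_\diamond\le\delta$. Here $\|\Phi-\Phi'\|_\diamond$ is the supremum of $\|(\mathcal I_d\otimes\Phi)(\rho)-(\mathcal I_d\otimes\Phi')(\rho)\|_1$ over all $d$ and all density matrices $\rho$ on a $d$-dimensional ancilla and the input system. Let $\mathsf R_{0,A\to B}(f)$ be the zero-error classical one-way communication complexity of $f$: the least number of bits of a message from Alice, who holds $x$, that allows Bob, who holds $y$, to output $f(x,y)$ with probability $1$ for all $x,y$. Let $\mathsf R_{0,B\to A}(f)$ be the same with the roles of Alice and Bob exchanged. Let $\epsilon,\delta\ge 0$ with $\epsilon+\delta<2\bigl(1-\tfrac1{\sqrt2}\bigr)$ (for example $\epsilon=\delta=0.09$). There is a constant $C>0$, depending only on $\epsilon$ and $\delta$, such that for all $n$, $f$, $E$, $q_A$, $q_B$, every $\epsilon$-correct and $\delta$-secure CDQS protocol for $f$ with these parameters satisfies $$2E+q_A+q_B\;\ge\;\tfrac12\bigl(\log\mathsf R_{0,B\to A}(f)+\log\mathsf R_{0,A\to B}(f)\bigr)-C\bigl(\log(1+q_A+E)+\log(1+q_B+E)\bigr).$$ In the notation that suppresses the dependence on $\log(q_A+E)$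 and $\log(q_B+E)$, $2E+q_A+q_B\ge\tilde\Omega\bigl(\log\mathsf R_{0,B\to A}(f)+\log\mathsf R_{0,A\to B}(f)\bigr)$. -/

import Mathlib

open scoped Kronecker ENNReal ComplexOrder

/-- Strings of `n` bits. They also label the computational basis of a system of `n` qubits. -/
abbrev Bits (n : ℕ) : Type := Fin n → Bool

namespace Quantum

/-- Square complex matrices with rows and columns labelled by `a`: the operators on the Hilbert
space with orthonormal basis `a`. -/
abbrev Op (a : Type*) : Type _ := Matrix a a ℂ

/-- Density matrices. -/
structure IsDensity {a : Type*} [Fintype a] (ρ : Op a) : Prop where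
  posSemidef : ρ.PosSemidef
  trace_eq_one : ρ.trace = 1

/-- The map `id_k ⊗ Φ`, acting on the second factor of a bipartite system. -/
def onSnd (k : Type*) {a b : Type*} (Φ : Op a →ₗ[ℂ] Op b) : Op (k × a) →ₗ[ℂ] Op (k × b) where
  toFun X := Matrix.of fun p q => Φ (Matrix.of fun c d => X (p.1, c) (q.1, d)) p.2 q.2
  map_add' X Y := by
    ext p q
    exact congrFun (congrFun (map_add Φ (Matrix.of fun c d => X (p.1, c) (q.1, d))
      (Matrix.of fun c d => Y (p.1, c) (q.1, d))) p.2) q.2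
  map_smul' z X := by
    ext p q
    exact congrFun (congrFun (map_smul Φ z (Matrix.of fun c d => X (p.1, c) (q.1, d))) p.2) q.2

/-- The map `Φ ⊗ id_k`, acting on the first factor of a bipartite system. -/
def onFst (k : Type*) {a b : Type*} (Φ : Op a →ₗ[ℂ] Op b) : Op (a × k) →ₗ[ℂ] Op (b × k) where
  toFun X := Matrix.of fun p q => Φ (Matrix.of fun c d => X (c, p.2) (d, q.2)) p.1 q.1
  map_add' X Y := by
    ext p q
    exact congrFun (congrFun (map_add Φ (Matrix.of fun c d => X (c, p.2) (d, q.2))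
      (Matrix.of fun c d => Y (c, p.2) (d, q.2))) p.1) q.1
  map_smul' z X := by
    ext p q
    exact congrFun (congrFun (map_smul Φ z (Matrix.of fun c d => X (c, p.2) (d, q.2))) p.1) q.1

/-- The tensor product `Φ ⊗ Ψ` of two maps acting on different systems. -/
def tensorMap {a b c d : Type*} (Φ : Op a →ₗ[ℂ] Op b) (Ψ : Op c →ₗ[ℂ] Op d) :
    Op (a × c) →ₗ[ℂ] Op (b × d) :=
  onFst d Φ ∘ₗ onSnd a Ψ

/-- Quantum channels: completely positive trace-preserving linear maps. -/
structure IsChannel {a b : Type*} [Fintype a] [Fintype b] (Φ : Op a →ₗ[ℂ] Op b) : Prop where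
  completelyPositive : ∀ (k : ℕ) (X : Op (Fin k × a)),
    X.PosSemidef → (onSnd (Fin k) Φ X).PosSemidef
  tracePreserving : ∀ X : Op a, (Φ X).trace = X.trace

/-- The trace norm `‖A‖₁ = tr √(A† A)`: the sum of the singular values of `A`. -/
noncomputable def traceNorm {a : Type*} [Fintype a] [DecidableEq a] (A : Op a) : ℝ :=
  ∑ i, √((Matrix.isHermitian_conjTranspose_mul_self A).eigenvalues i)

/-- The diamond norm distance: the supremum of `‖(id_d ⊗ Φ)(ρ) - (id_d ⊗ Ψ)(ρ)‖₁` over all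
dimensions `d` of the ancilla and all density matrices `ρ` of ancilla and input. -/
noncomputable def diamondDist {a b : Type*} [Fintype a] [Fintype b] [DecidableEq b]
    (Φ Ψ : Op a →ₗ[ℂ] Op b) : ℝ≥0∞ :=
  ⨆ (d : ℕ) (ρ : Op (Fin d × a)) (_ : IsDensity ρ),
    ENNReal.ofReal (traceNorm (onSnd (Fin d) Φ ρ - onSnd (Fin d) Ψ ρ))

/-- The channel that discards its input and prepares the state `σ`, `X ↦ tr(X) σ`. -/
noncomputable def prepare (a : Type*) {b : Type*} [Fintype a] (σ : Op b) : Op a →ₗ[ℂ] Op b :=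
  (Matrix.traceLinearMap a ℂ ℂ).smulRight σ

/-- The map `X ↦ X_Q ⊗ Ψ_{LR}` that adjoins a state of `LR`, with the systems grouped as
`(QL)R`. -/
def adjoin (q : Type*) {l r : Type*} (Ψ : Op (l × r)) : Op q →ₗ[ℂ] Op ((q × l) × r) where
  toFun X := (X ⊗ₖ Ψ).submatrix (Equiv.prodAssoc q l r) (Equiv.prodAssoc q l r)
  map_add' X Y := by
    ext p s
    simp [Matrix.kroneckerMap_apply, add_mul]
  map_smul' z X := by
    ext p s
    simp [Matrix.kroneckerMap_apply, mul_assoc]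

/-- The operations of Alice and Bob in a protocol for conditional disclosure of a one-qubit secret
`Q`, on inputs of `n` bits, with a shared resource state on `L` (Alice) and `R` (Bob) of `E` qubits
each, a message `M_A` of `qA` qubits from Alice and a message `M_B` of `qB` qubits from Bob. -/
structure CDQSProtocol (n E qA qB : ℕ) where
  resource : Op (Bits E × Bits E)
  resource_isDensity : IsDensity resource
  alice : Bits n → Op (Fin 2 × Bits E) →ₗ[ℂ] Op (Bits qA)
  alice_isChannel : ∀ x, IsChannel (alice x)
  bob : Bits n → Op (Bits E) →ₗ[ℂ] Op (Bits qB)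
  bob_isChannel : ∀ y, IsChannel (bob y)

namespace CDQSProtocol

variable {n E qA qB : ℕ}

/-- The combined action of Alice and Bob, from the secret `Q` to the messages `M_A M_B`. -/
def encode (P : CDQSProtocol n E qA qB) (x y : Bits n) :
    Op (Fin 2) →ₗ[ℂ] Op (Bits qA × Bits qB) :=
  tensorMap (P.alice x) (P.bob y) ∘ₗ adjoin (Fin 2) P.resource

/-- `ε`-correctness: if `f x y = 1` the referee, who knows `x` and `y`, can recover the secret. -/
def IsCorrect (P : CDQSProtocol n E qA qB) (f : Bits n → Bits n → Bool) (ε : ℝ) : Prop :=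
  ∀ x y, f x y = true → ∃ D : Op (Bits qA × Bits qB) →ₗ[ℂ] Op (Fin 2),
    IsChannel D ∧ diamondDist (D ∘ₗ P.encode x y) LinearMap.id ≤ ENNReal.ofReal ε

/-- `δ`-security: if `f x y = 0` the messages can be simulated without the secret. A channel from
the trivial system to `M_A M_B` is the preparation of a state `σ`. -/
def IsSecure (P : CDQSProtocol n E qA qB) (f : Bits n → Bits n → Bool) (δ : ℝ) : Prop :=
  ∀ x y, f x y = false → ∃ σ : Op (Bits qA × Bits qB),
    IsDensity σ ∧ diamondDist (prepare (Fin 2) σ) (P.encode x y) ≤ ENNReal.ofReal δ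

end CDQSProtocol

end Quantum

/-- A classical (randomized) one-way protocol with a message of `m` bits: on input `x` the sender
draws a message from `send x`, and on input `y` and message `t` the receiver draws the output bit
from `output y t`. -/
structure OneWayProtocol (n m : ℕ) where
  send : Bits n → PMF (Bits m)
  output : Bits n → Bits m → PMF Bool

/-- On all inputs the output bit is `f x y` with probability at least `1 - δ`. -/
def OneWayProtocol.IsCorrect {n m : ℕ} (P : OneWayProtocol n m) (f : Bits n → Bits n → Bool)
    (δ : ℝ) : Prop :=
  ∀ x y, 1 - δ ≤ (((P.send x).bind (P.output y)) (f x y)).toReal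

/-- `R_{δ,A→B}(f)`: the least number of message bits from Alice, who holds `x`, to Bob, who
holds `y`, in a `δ`-correct one-way protocol for `f`. -/
noncomputable def oneWayAB {n : ℕ} (δ : ℝ) (f : Bits n → Bits n → Bool) : ℕ :=
  sInf {m | ∃ P : OneWayProtocol n m, P.IsCorrect f δ}

/-- `R_{δ,B→A}(f)`: the same with the roles of Alice and Bob exchanged. -/
noncomputable def oneWayBA {n : ℕ} (δ : ℝ) (f : Bits n → Bits n → Bool) : ℕ :=
  oneWayAB δ (fun y x => f x y)

/-! The argument is counting. On basis-state secrets, the message state depends on `x` only through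
Alice's channel, whose `4 ^ (E + qA + 1)` complex matrix entries have modulus at most 1
(`IsChannel.norm_apply_single_le_one`). Rounding them gives a class of the input. Two channels in
one class are so close that, whatever Bob does, every binary measurement has bias within 1/4 on the
two message states; the bound of `norm_trace_mul_onFst_le` is independent of Bob's system.

Correctness forces some measurement to separate the secrets 0 and 1 by at least `2 - 2 * ε`, while
security allows at most `2 * δ`. As `ε + δ < 3 / 4`, inputs in one class have the same value against
every `y` (`eq_of_encode_close`). So Alice can send her class, deterministically and without error,
in about `4 ^ (E + qA)` bits up to a linear factor. Bob's side is symmetric. Averaging the two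
logarithms gives `2 * E + qA + qB` plus terms absorbed by `C`. -/

namespace Quantum

open scoped Matrix.Norms.L2Operator
open Matrix

/-! ### Trace and operator norm inequalities. -/

section Trace

variable {a b : Type*} [Fintype a] [DecidableEq a] [Fintype b] [DecidableEq b]

/-- A trace is bounded through the images of an orthonormal basis. -/
lemma norm_trace_mul_le_sum (v : OrthonormalBasis a ℂ (EuclideanSpace ℂ a)) (T A : Op a) :
    ‖(T * A).trace‖ ≤ ‖T‖ * ∑ i, ‖toEuclideanLin A (v i)‖ := by
  have h : (T * A).trace = ∑ i, inner ℂ (v i) (toEuclideanLin (T * A) (v i)) := by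
    rw [← LinearMap.trace_eq_sum_inner, Matrix.toEuclideanLin_eq_toLin_orthonormal,
      Matrix.trace_toLin_eq]
  rw [h, Finset.mul_sum]
  refine (norm_sum_le _ _).trans (Finset.sum_le_sum fun i _ => ?_)
  refine (norm_inner_le_norm _ _).trans ?_
  rw [v.norm_eq_one, one_mul]
  have := Matrix.l2_opNorm_mulVec T (toEuclideanLin A (v i))
  simpa [Matrix.toLpLin_apply, Matrix.mulVec_mulVec] using this

lemma norm_sq_toEuclideanLin (A : Op a) (v : EuclideanSpace ℂ a) :
    ‖toEuclideanLin A v‖ ^ 2 = (star v.ofLp ⬝ᵥ ((Aᴴ * A) *ᵥ v.ofLp)).re := by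
  rw [@norm_sq_eq_re_inner ℂ, EuclideanSpace.inner_eq_star_dotProduct, dotProduct_comm]
  simp [Matrix.toLpLin_apply, Matrix.star_mulVec, ← Matrix.dotProduct_mulVec]

/-- Hölder's inequality for the trace norm and the operator norm. -/
lemma norm_trace_mul_le_traceNorm (T A : Op a) : ‖(T * A).trace‖ ≤ ‖T‖ * traceNorm A := by
  set h := Matrix.isHermitian_conjTranspose_mul_self A
  refine (norm_trace_mul_le_sum h.eigenvectorBasis T A).trans_eq ?_
  unfold traceNorm
  congr 1
  refine Finset.sum_congr rfl fun i _ => ?_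
  rw [eq_comm, Real.sqrt_eq_iff_mul_self_eq
    (Matrix.eigenvalues_conjTranspose_mul_self_nonneg A i) (norm_nonneg _), h.eigenvalues_eq,
    ← sq, norm_sq_toEuclideanLin]
  rfl

lemma norm_trace_mul_le_of_posSemidef (K : Op a) {Y : Op a} (hY : Y.PosSemidef) :
    ‖(K * Y).trace‖ ≤ ‖K‖ * Y.trace.re := by
  refine (norm_trace_mul_le_sum hY.1.eigenvectorBasis K Y).trans_eq ?_
  rw [hY.1.trace_eq_sum_eigenvalues]
  simp only [Complex.coe_algebraMap, Complex.re_sum, Complex.ofReal_re]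
  congr 1
  refine Finset.sum_congr rfl fun i _ => ?_
  have : toEuclideanLin Y (hY.1.eigenvectorBasis i)
      = (hY.1.eigenvalues i : ℂ) • hY.1.eigenvectorBasis i := by
    ext j
    simpa [Matrix.toLpLin_apply] using congrFun (hY.1.mulVec_eigenvectorBasis i) j
  rw [this, norm_smul, OrthonormalBasis.norm_eq_one, mul_one, Complex.norm_real,
    Real.norm_of_nonneg (hY.eigenvalues_nonneg i)]

lemma norm_le_one_of_posSemidef_one_sub {T : Op a} (h : (1 - Tᴴ * T).PosSemidef) : ‖T‖ ≤ 1 := by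
  rw [Matrix.l2_opNorm_def]
  refine ContinuousLinearMap.opNorm_le_bound _ zero_le_one fun v => ?_
  rw [one_mul]
  refine le_of_sq_le_sq ?_ (norm_nonneg v)
  have := h.re_dotProduct_nonneg v.ofLp
  have h1 : ‖v‖ ^ 2 = (star v.ofLp ⬝ᵥ v.ofLp).re := by
    simpa [Matrix.toLpLin_apply] using norm_sq_toEuclideanLin 1 v
  have h2 := norm_sq_toEuclideanLin T v
  rw [Matrix.sub_mulVec, dotProduct_sub, Matrix.one_mulVec, map_sub] at this
  change ‖toEuclideanLin T v‖ ^ 2 ≤ _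
  rw [h1, h2]
  exact sub_nonneg.1 this

/-- The difference of the two effects of a binary measurement is a contraction. -/
lemma norm_sub_le_one {P Q : Op a} (hP : P.PosSemidef) (hQ : Q.PosSemidef) (hPQ : P + Q = 1) :
    ‖P - Q‖ ≤ 1 := by
  apply norm_le_one_of_posSemidef_one_sub
  have hQ' : Q = 1 - P := eq_sub_of_add_eq' hPQ
  have h1 := hQ.conjTranspose_mul_mul_same P
  have h2 := hP.conjTranspose_mul_mul_same Q
  rw [hP.1.eq] at h1
  rw [hQ.1.eq] at h2
  -- With `Q = 1 - P`, `1 - (P - Q)² = 4PQ = 4(PQP + QPQ)`, and the last form is visibly positive.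
  have h := (h1.add h2).smul (show (0 : ℂ) ≤ 4 by norm_num)
  convert h using 1
  rw [(hP.1.sub hQ.1).eq, hQ']
  rw [show (4 : ℂ) • (P * (1 - P) * P + (1 - P) * P * (1 - P)) =
    (4 : ℕ) • (P * (1 - P) * P + (1 - P) * P * (1 - P)) by norm_cast]
  noncomm_ring

/-- By the C*-identity it suffices to bound `X† X`, which is a diagonal projection. -/
lemma norm_single_kronecker_one_le (i : a) (j : b) (c : Type*) [Fintype c] [DecidableEq c] :
    ‖(Matrix.single i j (1 : ℂ)) ⊗ₖ (1 : Op c)‖ ≤ 1 := by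
  have h : ‖((Matrix.single i j (1 : ℂ)) ⊗ₖ (1 : Op c))ᴴ *
      ((Matrix.single i j (1 : ℂ)) ⊗ₖ (1 : Op c))‖ ≤ 1 := by
    rw [Matrix.conjTranspose_kronecker, ← Matrix.mul_kronecker_mul]
    have e : ((Matrix.single i j (1 : ℂ))ᴴ * Matrix.single i j (1 : ℂ)) ⊗ₖ ((1 : Op c)ᴴ * 1) =
        Matrix.diagonal fun p : b × c => if p.1 = j then 1 else 0 := by
      ext p q
      by_cases h1 : p.1 = j <;> by_cases h2 : q.1 = j <;> by_cases h3 : p.2 = q.2 <;>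
        simp [Matrix.diagonal_apply, Matrix.one_apply, Prod.ext_iff, h1, h2,
          h3, @eq_comm _ j]
    rw [e, Matrix.l2_opNorm_diagonal]
    refine (pi_norm_le_iff_of_nonneg zero_le_one).2 fun p => ?_
    by_cases hp : p.1 = j <;> simp [hp]
  rw [Matrix.l2_opNorm_conjTranspose_mul_self] at h
  nlinarith [norm_nonneg ((Matrix.single i j (1 : ℂ)) ⊗ₖ (1 : Op c))]

end Trace

/-! ### Channels, their matrix entries, and measurements. -/

section Channel

variable {a b c k : Type*}

lemma linearMap_apply_eq_sum [Fintype a] [DecidableEq a] (Φ : Op a →ₗ[ℂ] Op b) (X : Op a) (p q : b) :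
    Φ X p q = ∑ i, ∑ j, X i j * Φ (Matrix.single i j 1) p q := by
  conv_lhs => rw [Matrix.matrix_eq_sum_single X]
  simp only [map_sum, Matrix.sum_apply]
  refine Finset.sum_congr rfl fun i _ => Finset.sum_congr rfl fun j _ => ?_
  rw [show Matrix.single i j (X i j) = X i j • Matrix.single i j (1 : ℂ) by simp, map_smul]
  simp

/-- The principal 2 × 2 minor on `i`, `j` is nonnegative. -/
lemma norm_entry_le_one_of_posSemidef {M : Op a} (hM : M.PosSemidef) (h1 : ∀ i, (M i i).re ≤ 1)
    (i j : a) : ‖M i j‖ ≤ 1 := by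
  have hdet := (hM.submatrix ![i, j]).det_nonneg
  have hji : M j i = star (M i j) := (hM.1.apply j i).symm
  have hi := Complex.nonneg_iff.1 (hM.diag_nonneg (i := i))
  have hj := Complex.nonneg_iff.1 (hM.diag_nonneg (i := j))
  rw [Matrix.det_fin_two] at hdet
  simp only [Matrix.submatrix_apply, Matrix.cons_val_zero, Matrix.cons_val_one, hji] at hdet
  have h := (Complex.nonneg_iff.1 hdet).1
  rw [Complex.star_def, Complex.mul_conj, Complex.sub_re, Complex.mul_re, ← hi.2, zero_mul,
    sub_zero, Complex.ofReal_re, Complex.normSq_eq_norm_sq] at h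
  nlinarith [h1 i, h1 j, norm_nonneg (M i j), hi.1, hj.1]

/-- Allows either party's channel to be treated as the one applied last. -/
lemma onFst_onSnd_comm {d : Type*} [Fintype a] [Fintype c] (Φ : Op a →ₗ[ℂ] Op b) (Ψ : Op c →ₗ[ℂ] Op d)
    (X : Op (a × c)) : onFst d Φ (onSnd a Ψ X) = onSnd b Ψ (onFst c Φ X) := by
  classical
  ext p q
  change Φ (Matrix.of fun i j => Ψ (Matrix.of fun k l => X (i, k) (j, l)) p.2 q.2) p.1 q.1 =
    Ψ (Matrix.of fun k l => Φ (Matrix.of fun i j => X (i, k) (j, l)) p.1 q.1) p.2 q.2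
  rw [linearMap_apply_eq_sum Φ, linearMap_apply_eq_sum Ψ]
  simp only [Matrix.of_apply]
  simp_rw [linearMap_apply_eq_sum Φ (Matrix.of _), linearMap_apply_eq_sum Ψ (Matrix.of _),
    Matrix.of_apply, Finset.sum_mul, ← Fintype.sum_prod_type']
  exact Fintype.sum_equiv ⟨fun x => (x.2.2.1, x.2.2.2, x.1, x.2.1),
    fun x => (x.2.2.1, x.2.2.2, x.1, x.2.1), fun _ => rfl, fun _ => rfl⟩ _ _
    fun x => mul_right_comm _ _ _

variable [Fintype a] [Fintype b] [Fintype c] [Fintype k]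

lemma IsChannel.posSemidef_onSnd {Φ : Op a →ₗ[ℂ] Op b} (hΦ : IsChannel Φ) {X : Op (k × a)}
    (hX : X.PosSemidef) : (onSnd k Φ X).PosSemidef := by
  let e := Fintype.equivFin k
  have h := hΦ.completelyPositive _ (X.submatrix (Prod.map e.symm id) (Prod.map e.symm id))
    (hX.submatrix _)
  convert h.submatrix (Prod.map e id) using 1
  ext p q
  simp [onSnd]

lemma IsChannel.trace_onSnd {Φ : Op a →ₗ[ℂ] Op b} (hΦ : IsChannel Φ) (X : Op (k × a)) :
    (onSnd k Φ X).trace = X.trace := by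
  simp only [Matrix.trace, Fintype.sum_prod_type, Matrix.diag_apply]
  exact Finset.sum_congr rfl fun i _ =>
    hΦ.tracePreserving (Matrix.of fun c d => X (i, c) (i, d))

lemma IsChannel.isDensity_onSnd {Φ : Op a →ₗ[ℂ] Op b} (hΦ : IsChannel Φ) {X : Op (k × a)}
    (hX : IsDensity X) : IsDensity (onSnd k Φ X) :=
  ⟨hΦ.posSemidef_onSnd hX.posSemidef, (hΦ.trace_onSnd X).trans hX.trace_eq_one⟩

lemma IsDensity.submatrix_equiv {ρ : Op a} (hρ : IsDensity ρ) (e : b ≃ a) :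
    IsDensity (ρ.submatrix e e) :=
  ⟨hρ.posSemidef.submatrix e, by
    rw [← hρ.trace_eq_one]; exact e.sum_comp fun i => ρ i i⟩

lemma IsChannel.isDensity_onFst {Φ : Op a →ₗ[ℂ] Op b} (hΦ : IsChannel Φ) {X : Op (a × k)}
    (hX : IsDensity X) : IsDensity (onFst k Φ X) :=
  (hΦ.isDensity_onSnd (hX.submatrix_equiv (Equiv.prodComm k a))).submatrix_equiv
    (Equiv.prodComm b k)

/-- The Choi matrix of a channel is positive semidefinite. -/
lemma IsChannel.posSemidef_choi [DecidableEq a] {Φ : Op a →ₗ[ℂ] Op b} (hΦ : IsChannel Φ) :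
    (Matrix.of fun p q : a × b => Φ (Matrix.single p.1 q.1 1) p.2 q.2).PosSemidef := by
  -- The Choi matrix is the image of the unnormalised maximally entangled projector.
  have h := hΦ.posSemidef_onSnd (Matrix.posSemidef_vecMulVec_self_star
    (fun p : a × a => if p.1 = p.2 then (1 : ℂ) else 0))
  convert h using 1
  ext p q
  simp only [onSnd, Matrix.of_apply, LinearMap.coe_mk, AddHom.coe_mk]
  refine congrArg (fun M => Φ M p.2 q.2) ?_
  ext i j
  by_cases h1 : p.1 = i <;> by_cases h2 : q.1 = j <;>
    simp [Matrix.vecMulVec_apply, h1, h2]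

/-- Diagonal Choi entries are at most 1 because a basis state has an output of trace 1; positivity
then controls the other entries. -/
lemma IsChannel.norm_apply_single_le_one [DecidableEq a] {Φ : Op a →ₗ[ℂ] Op b}
    (hΦ : IsChannel Φ) (i j : a) (p q : b) : ‖Φ (Matrix.single i j 1) p q‖ ≤ 1 := by
  have hC := hΦ.posSemidef_choi
  refine norm_entry_le_one_of_posSemidef hC (fun r => ?_) (i, p) (j, q)
  have ht : ∑ s, Φ (Matrix.single r.1 r.1 1) s s = 1 := by
    simpa [Matrix.trace] using hΦ.tracePreserving (Matrix.single r.1 r.1 1)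
  have hre := congrArg Complex.re ht
  rw [Complex.re_sum, Complex.one_re] at hre
  rw [← hre]
  exact Finset.single_le_sum (f := fun s => (Φ (Matrix.single r.1 r.1 1) s s).re)
    (fun s _ => (Complex.nonneg_iff.1 (hC.diag_nonneg (i := (r.1, s)))).1) (Finset.mem_univ r.2)

/-- Measuring the output qubit of a channel is a binary measurement of its input. -/
lemma IsChannel.exists_effects [DecidableEq a] {D : Op a →ₗ[ℂ] Op (Fin 2)} (hD : IsChannel D) :
    ∃ P Q : Op a, P.PosSemidef ∧ Q.PosSemidef ∧ P + Q = 1 ∧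
      ∀ X, ((P - Q) * X).trace = D X 0 0 - D X 1 1 := by
  -- The effects are the images of the output basis projections under the adjoint of `D`: transposed
  -- blocks of the Choi matrix.
  have key : ∀ s, ∃ P : Op a, P.PosSemidef ∧ ∀ i j, P i j = D (Matrix.single j i 1) s s :=
    fun s => ⟨_, (hD.posSemidef_choi.submatrix fun i => (i, s)).transpose, fun i j => rfl⟩
  obtain ⟨P, hP, hP'⟩ := key 0
  obtain ⟨Q, hQ, hQ'⟩ := key 1
  refine ⟨P, Q, hP, hQ, ?_, fun X => ?_⟩
  · ext i j
    rw [Matrix.add_apply, hP', hQ']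
    have := hD.tracePreserving (Matrix.single j i 1)
    rw [Matrix.trace_fin_two] at this
    rw [this]
    by_cases h : i = j
    · subst h; simp
    · rw [Matrix.trace_single_eq_of_ne _ _ _ (Ne.symm h), Matrix.one_apply_ne h]
  · have : ∀ (M : Op a) s, (∀ i j, M i j = D (Matrix.single j i 1) s s) →
        (M * X).trace = D X s s := by
      intro M s hM
      rw [linearMap_apply_eq_sum D X, Finset.sum_comm]
      simp [Matrix.trace, Matrix.mul_apply, hM, mul_comm]
    rw [sub_mul, Matrix.trace_sub, this P 0 hP', this Q 1 hQ']

/-- Hölder against the contraction `P - Q`; the one-dimensional ancilla suffices. -/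
lemma norm_trace_sub_mul_le_of_diamondDist_le [DecidableEq b] {Φ Ψ : Op a →ₗ[ℂ] Op b} {ε : ℝ} (hε : 0 ≤ ε)
    (h : diamondDist Φ Ψ ≤ ENNReal.ofReal ε) {ρ : Op a} (hρ : IsDensity ρ) {P Q : Op b}
    (hP : P.PosSemidef) (hQ : Q.PosSemidef) (hPQ : P + Q = 1) :
    ‖((P - Q) * (Φ ρ - Ψ ρ)).trace‖ ≤ ε := by
  let ea : Fin 1 × a ≃ a := Equiv.uniqueProd a (Fin 1)
  let eb : Fin 1 × b ≃ b := Equiv.uniqueProd b (Fin 1)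
  have h1 : ENNReal.ofReal (traceNorm (onSnd (Fin 1) Φ (ρ.submatrix ea ea) -
      onSnd (Fin 1) Ψ (ρ.submatrix ea ea))) ≤ ENNReal.ofReal ε := by
    refine le_trans ?_ h
    unfold diamondDist
    exact le_iSup_of_le 1 <| le_iSup_of_le (ρ.submatrix ea ea) <|
      le_iSup_of_le (hρ.submatrix_equiv ea) le_rfl
  have e : onSnd (Fin 1) Φ (ρ.submatrix ea ea) - onSnd (Fin 1) Ψ (ρ.submatrix ea ea) =
      (Φ ρ - Ψ ρ).submatrix eb eb := rfl
  rw [ENNReal.ofReal_le_ofReal_iff hε, e] at h1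
  have h2 : ‖P.submatrix eb eb - Q.submatrix eb eb‖ ≤ 1 :=
    norm_sub_le_one (hP.submatrix eb) (hQ.submatrix eb) (by
      change (P + Q).submatrix eb eb = 1
      rw [hPQ, Matrix.submatrix_one_equiv])
  have h3 := norm_trace_mul_le_traceNorm (P.submatrix eb eb - Q.submatrix eb eb)
    ((Φ ρ - Ψ ρ).submatrix eb eb)
  have h4 : ((P.submatrix eb eb - Q.submatrix eb eb) * (Φ ρ - Ψ ρ).submatrix eb eb).trace =
      ((P - Q) * (Φ ρ - Ψ ρ)).trace := by
    change ((P - Q).submatrix eb eb * (Φ ρ - Ψ ρ).submatrix eb eb).trace = _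
    rw [Matrix.submatrix_mul_equiv]
    exact eb.sum_comp fun i => ((P - Q) * (Φ ρ - Ψ ρ)) i i
  rw [h4] at h3
  have h5 : 0 ≤ traceNorm ((Φ ρ - Ψ ρ).submatrix eb eb) :=
    Finset.sum_nonneg fun i _ => Real.sqrt_nonneg _
  nlinarith

variable [DecidableEq a] [DecidableEq b] [DecidableEq c]

lemma onFst_eq_sum (Φ : Op a →ₗ[ℂ] Op b) (Y : Op (a × c)) :
    onFst c Φ Y = ∑ i, ∑ j, ∑ p, ∑ q, Φ (Matrix.single i j 1) p q •
      ((Matrix.single p i (1 : ℂ) ⊗ₖ (1 : Op c)) * Y * (Matrix.single j q (1 : ℂ) ⊗ₖ (1 : Op c))) := by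
  ext r s
  have e : ∀ i j p q, ((Matrix.single p i (1 : ℂ) ⊗ₖ (1 : Op c)) * Y *
      (Matrix.single j q (1 : ℂ) ⊗ₖ (1 : Op c))) r s =
        if p = r.1 then (if q = s.1 then Y (i, r.2) (j, s.2) else 0) else 0 := by
    intro i j p q
    by_cases hp : p = r.1 <;> by_cases hq : q = s.1 <;>
    simp [Matrix.mul_apply, Fintype.sum_prod_type, Matrix.single_apply, Matrix.one_apply,
      hp, hq]
  change Φ (Matrix.of fun i j => Y (i, r.2) (j, s.2)) r.1 s.1 = _
  rw [linearMap_apply_eq_sum]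
  simp only [Matrix.sum_apply, Matrix.smul_apply, e]
  simp [mul_comm]

/-- If all matrix entries of `Φ` are small, then `Φ ⊗ id` maps states to operators that no
contraction distinguishes from zero. The bound does not depend on the second system. -/
lemma norm_trace_mul_onFst_le {Φ : Op a →ₗ[ℂ] Op b} {η : ℝ}
    (hΦ : ∀ i j p q, ‖Φ (Matrix.single i j 1) p q‖ ≤ η) {T : Op (b × c)} (hT : ‖T‖ ≤ 1)
    {Y : Op (a × c)} (hY : IsDensity Y) :
    ‖(T * onFst c Φ Y).trace‖ ≤ (Fintype.card a * Fintype.card b) ^ 2 * η := by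
  have key : ∀ i j p q, ‖(T * (Φ (Matrix.single i j 1) p q •
      ((Matrix.single p i (1 : ℂ) ⊗ₖ (1 : Op c)) * Y *
        (Matrix.single j q (1 : ℂ) ⊗ₖ (1 : Op c))))).trace‖ ≤ η := by
    intro i j p q
    rw [Matrix.mul_smul, Matrix.trace_smul, norm_smul]
    have h1 := norm_single_kronecker_one_le p i c
    have h2 := norm_single_kronecker_one_le j q c
    set S := Matrix.single p i (1 : ℂ) ⊗ₖ (1 : Op c)
    set R := Matrix.single j q (1 : ℂ) ⊗ₖ (1 : Op c)
    have h3 : ‖R * (T * S)‖ ≤ 1 :=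
      (Matrix.l2_opNorm_mul _ _).trans <| mul_le_one₀ h2 (norm_nonneg _) <|
        (Matrix.l2_opNorm_mul _ _).trans <| mul_le_one₀ hT (norm_nonneg _) h1
    have h4 : ‖(T * (S * Y * R)).trace‖ ≤ 1 := by
      -- Cyclicity gathers the three contractions into a single factor before the state `Y`.
      rw [← Matrix.mul_assoc, Matrix.trace_mul_comm, ← Matrix.mul_assoc, ← Matrix.mul_assoc,
        Matrix.mul_assoc R]
      refine (norm_trace_mul_le_of_posSemidef _ hY.posSemidef).trans ?_
      rw [hY.trace_eq_one, Complex.one_re, mul_one]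
      exact h3
    calc _ ≤ η * 1 := mul_le_mul (hΦ i j p q) h4 (norm_nonneg _)
          ((norm_nonneg _).trans (hΦ i j p q))
      _ = η := mul_one η
  rw [onFst_eq_sum]
  simp only [Matrix.mul_sum, Matrix.trace_sum]
  calc _ ≤ ∑ i : a, ∑ j : a, ∑ p : b, ∑ q : b, η :=
        norm_sum_le_of_le _ fun i _ => norm_sum_le_of_le _ fun j _ =>
          norm_sum_le_of_le _ fun p _ => norm_sum_le_of_le _ fun q _ => key i j p q
    _ = _ := by simp; ring

end Channel

section

variable {a b c : Type*} [Fintype a] [Fintype b] [Fintype c]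

lemma IsDensity.adjoin {ρ : Op a} (hρ : IsDensity ρ) {Ψ : Op (b × c)} (hΨ : IsDensity Ψ) :
    IsDensity (adjoin a Ψ ρ) := by
  refine IsDensity.submatrix_equiv (ρ := ρ ⊗ₖ Ψ) ⟨hρ.posSemidef.kronecker hΨ.posSemidef, ?_⟩ _
  rw [Matrix.trace_kronecker, hρ.trace_eq_one, hΨ.trace_eq_one, one_mul]

lemma isDensity_single [DecidableEq a] (i : a) : IsDensity (Matrix.single i i 1 : Op a) :=
  ⟨by
    rw [← Matrix.diagonal_single]
    exact Matrix.PosSemidef.diagonal (Pi.single_nonneg.2 zero_le_one), by simp⟩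

variable [DecidableEq a] [DecidableEq b] [DecidableEq c]

lemma norm_trace_mul_onSnd_le {Φ : Op a →ₗ[ℂ] Op b} {η : ℝ}
    (hΦ : ∀ i j p q, ‖Φ (Matrix.single i j 1) p q‖ ≤ η) {P Q : Op (c × b)}
    (hP : P.PosSemidef) (hQ : Q.PosSemidef) (hPQ : P + Q = 1)
    {Y : Op (c × a)} (hY : IsDensity Y) :
    ‖((P - Q) * onSnd c Φ Y).trace‖ ≤ (Fintype.card a * Fintype.card b) ^ 2 * η := by
  let e : b × c ≃ c × b := Equiv.prodComm b c
  have hT : ‖P.submatrix e e - Q.submatrix e e‖ ≤ 1 :=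
    norm_sub_le_one (hP.submatrix e) (hQ.submatrix e) (by
      change (P + Q).submatrix e e = 1
      rw [hPQ, Matrix.submatrix_one_equiv])
  have h := norm_trace_mul_onFst_le hΦ hT (hY.submatrix_equiv (Equiv.prodComm a c))
  have h' : onFst c Φ (Y.submatrix (Equiv.prodComm a c) (Equiv.prodComm a c)) =
      (onSnd c Φ Y).submatrix e e := rfl
  have ht : ((P.submatrix e e - Q.submatrix e e) * (onSnd c Φ Y).submatrix e e).trace =
      ((P - Q) * onSnd c Φ Y).trace := by
    change ((P - Q).submatrix e e * (onSnd c Φ Y).submatrix e e).trace = _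
    rw [Matrix.submatrix_mul_equiv]
    exact e.sum_comp fun i => ((P - Q) * onSnd c Φ Y) i i
  rwa [h', ht] at h

end

/-! ### Correctness against security. -/

namespace CDQSProtocol

variable {n E qA qB : ℕ} (P : CDQSProtocol n E qA qB)

lemma isDensity_encode (x y : Bits n) {ρ : Op (Fin 2)} (hρ : IsDensity ρ) :
    IsDensity (P.encode x y ρ) :=
  (P.alice_isChannel x).isDensity_onFst
    ((P.bob_isChannel y).isDensity_onSnd (hρ.adjoin P.resource_isDensity))

variable {P} {f : Bits n → Bits n → Bool} {ε δ : ℝ}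

/-- If the secret can be recovered, some measurement of the messages determines a classical
secret. -/
lemma IsCorrect.exists_effects (hP : P.IsCorrect f ε) (hε : 0 ≤ ε) {x y : Bits n}
    (hf : f x y = true) : ∃ S R : Op (Bits qA × Bits qB), S.PosSemidef ∧ R.PosSemidef ∧ S + R = 1 ∧
      2 - 2 * ε ≤ ‖((S - R) * P.encode x y (Matrix.single 0 0 1)).trace -
        ((S - R) * P.encode x y (Matrix.single 1 1 1)).trace‖ := by
  obtain ⟨D, hD, hdist⟩ := hP x y hf
  obtain ⟨S, R, hS, hR, hSR, hD'⟩ := hD.exists_effects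
  refine ⟨S, R, hS, hR, hSR, ?_⟩
  have hz : (Matrix.single 0 0 1 : Op (Fin 2)) + Matrix.single 1 1 1 = 1 := by
    ext i j; fin_cases i <;> fin_cases j <;> simp
  have ht : ∀ X : Op (Fin 2), (((Matrix.single 0 0 1 : Op (Fin 2)) - Matrix.single 1 1 1) * X).trace
      = X 0 0 - X 1 1 := by
    intro X; simp [sub_mul, Matrix.trace_sub, Matrix.trace_fin_two, Matrix.mul_apply]
  have h := fun s : Fin 2 => norm_trace_sub_mul_le_of_diamondDist_le hε hdist (isDensity_single s)
    (isDensity_single 0).posSemidef (isDensity_single 1).posSemidef hz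
  simp only [ht] at h
  rw [hD', hD']
  have h0 := h 0
  have h1 := h 1
  simp only [LinearMap.comp_apply, LinearMap.id_apply, Matrix.sub_apply] at h0 h1
  set A := D (P.encode x y (Matrix.single 0 0 1))
  set B := D (P.encode x y (Matrix.single 1 1 1))
  -- Perfect recovery would give biases 1 and -1; each actual bias is within `ε` of its ideal value.
  have e : (2 : ℂ) = (A 0 0 - A 1 1 - (B 0 0 - B 1 1)) -
      ((A 0 0 - (Matrix.single 0 0 1 : Op (Fin 2)) 0 0 -
        (A 1 1 - (Matrix.single 0 0 1 : Op (Fin 2)) 1 1)) -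
      (B 0 0 - (Matrix.single 1 1 1 : Op (Fin 2)) 0 0 -
        (B 1 1 - (Matrix.single 1 1 1 : Op (Fin 2)) 1 1))) := by
    simp; ring
  have h2 : ‖(2 : ℂ)‖ = 2 := by simp
  rw [e] at h2
  linarith [norm_sub_le (A 0 0 - A 1 1 - (B 0 0 - B 1 1))
      ((A 0 0 - (Matrix.single 0 0 1 : Op (Fin 2)) 0 0 -
        (A 1 1 - (Matrix.single 0 0 1 : Op (Fin 2)) 1 1)) -
      (B 0 0 - (Matrix.single 1 1 1 : Op (Fin 2)) 0 0 -
        (B 1 1 - (Matrix.single 1 1 1 : Op (Fin 2)) 1 1))),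
    norm_sub_le (A 0 0 - (Matrix.single 0 0 1 : Op (Fin 2)) 0 0 -
        (A 1 1 - (Matrix.single 0 0 1 : Op (Fin 2)) 1 1))
      (B 0 0 - (Matrix.single 1 1 1 : Op (Fin 2)) 0 0 -
        (B 1 1 - (Matrix.single 1 1 1 : Op (Fin 2)) 1 1))]

/-- If the secret is hidden, no measurement of the messages determines a classical secret. -/
lemma IsSecure.norm_trace_sub_le (hP : P.IsSecure f δ) (hδ : 0 ≤ δ) {x y : Bits n}
    (hf : f x y = false) {S R : Op (Bits qA × Bits qB)} (hS : S.PosSemidef) (hR : R.PosSemidef)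
    (hSR : S + R = 1) :
    ‖((S - R) * P.encode x y (Matrix.single 0 0 1)).trace -
        ((S - R) * P.encode x y (Matrix.single 1 1 1)).trace‖ ≤ 2 * δ := by
  obtain ⟨σ, hσ, hdist⟩ := hP x y hf
  have h := fun s : Fin 2 => norm_trace_sub_mul_le_of_diamondDist_le hδ hdist (isDensity_single s)
    hS hR hSR
  have hp : ∀ s : Fin 2, prepare (Fin 2) σ (Matrix.single s s 1) = σ := by
    intro s; simp [prepare]
  simp only [hp, mul_sub, Matrix.trace_sub] at h ⊢
  have h0 := h 0
  rw [norm_sub_rev] at h0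
  have := norm_sub_le_norm_sub_add_norm_sub
    ((S - R) * P.encode x y (Matrix.single 0 0 1)).trace ((S - R) * σ).trace
    ((S - R) * P.encode x y (Matrix.single 1 1 1)).trace
  simp only [sub_mul, Matrix.trace_sub] at this h0 ⊢
  have h1 := h 1
  simp only [sub_mul, Matrix.trace_sub] at h1
  linarith

/-- Inputs for which the messages are hard to distinguish have the same value. -/
lemma eq_of_encode_close (hc : P.IsCorrect f ε) (hs : P.IsSecure f δ) (hε : 0 ≤ ε) (hδ : 0 ≤ δ)
    (hεδ : ε + δ < 3 / 4) {x y x' y' : Bits n}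
    (h : ∀ S R : Op (Bits qA × Bits qB), S.PosSemidef → R.PosSemidef → S + R = 1 → ∀ s,
      ‖((S - R) * (P.encode x y (Matrix.single s s 1) -
        P.encode x' y' (Matrix.single s s 1))).trace‖ ≤ 1 / 4) :
    f x y = f x' y' := by
  wlog hf : f x y = true generalizing x y x' y'
  · cases hf' : f x' y'
    · simpa using hf
    · rw [← this (fun S R hS hR hSR s => ?_) hf', hf']
      rw [← neg_sub (P.encode x y _), mul_neg, Matrix.trace_neg, norm_neg]
      exact h S R hS hR hSR s
  · rw [hf]
    by_contra hne
    obtain ⟨S, R, hS, hR, hSR, h1⟩ := hc.exists_effects hε hf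
    have h2 := hs.norm_trace_sub_le hδ (x := x') (y := y') (by simpa using Ne.symm hne) hS hR hSR
    have h3 := h S R hS hR hSR 0
    have h4 := h S R hS hR hSR 1
    rw [mul_sub, Matrix.trace_sub] at h3 h4
    set A := ((S - R) * P.encode x y (Matrix.single 0 0 1)).trace
    set B := ((S - R) * P.encode x y (Matrix.single 1 1 1)).trace
    set A' := ((S - R) * P.encode x' y' (Matrix.single 0 0 1)).trace
    set B' := ((S - R) * P.encode x' y' (Matrix.single 1 1 1)).trace
    have e : A - B = (A' - B') + ((A - A') - (B - B')) := by ring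
    rw [e] at h1
    -- Otherwise `2 - 2 * ε ≤ 2 * δ + 1 / 4 + 1 / 4`, contradicting `ε + δ < 3 / 4`.
    linarith [norm_add_le (A' - B') ((A - A') - (B - B')), norm_sub_le (A - A') (B - B')]

/-- With empty messages nothing can be disclosed. -/
lemma IsCorrect.eq_false_of_empty {P : CDQSProtocol n E 0 0} (hc : P.IsCorrect f ε)
    (hε : 0 ≤ ε) (hε' : ε < 1) (x y : Bits n) : f x y = false := by
  by_contra hne
  obtain ⟨S, R, -, -, -, h⟩ := hc.exists_effects hε (by simpa using hne)
  -- A one-dimensional message space carries only one density matrix.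
  have e : P.encode x y (Matrix.single 0 0 1) = P.encode x y (Matrix.single 1 1 1) := by
    have h0 := (P.isDensity_encode x y (isDensity_single 0)).trace_eq_one
    have h1 := (P.isDensity_encode x y (isDensity_single 1)).trace_eq_one
    ext i j
    rw [Matrix.trace, Fintype.sum_subsingleton _ i] at h0 h1
    rw [Subsingleton.elim j i]
    exact h0.trans h1.symm
  rw [e, sub_self, norm_zero] at h
  linarith

lemma eq_of_alice_close (hc : P.IsCorrect f ε) (hs : P.IsSecure f δ) (hε : 0 ≤ ε) (hδ : 0 ≤ δ)
    (hεδ : ε + δ < 3 / 4) {η : ℝ}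
    (hη : ((Fintype.card (Fin 2 × Bits E) * Fintype.card (Bits qA) : ℝ)) ^ 2 * η ≤ 1 / 4)
    {x x' : Bits n}
    (h : ∀ i j p q, ‖(P.alice x - P.alice x') (Matrix.single i j 1) p q‖ ≤ η) (y : Bits n) :
    f x y = f x' y := by
  refine eq_of_encode_close hc hs hε hδ hεδ fun S R hS hR hSR s => le_trans ?_ hη
  have hY := (P.bob_isChannel y).isDensity_onSnd
    ((isDensity_single s).adjoin P.resource_isDensity)
  exact norm_trace_mul_onFst_le h (norm_sub_le_one hS hR hSR) hY

lemma eq_of_bob_close (hc : P.IsCorrect f ε) (hs : P.IsSecure f δ) (hε : 0 ≤ ε) (hδ : 0 ≤ δ)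
    (hεδ : ε + δ < 3 / 4) {η : ℝ}
    (hη : ((Fintype.card (Bits E) * Fintype.card (Bits qB) : ℝ)) ^ 2 * η ≤ 1 / 4)
    {y y' : Bits n}
    (h : ∀ i j p q, ‖(P.bob y - P.bob y') (Matrix.single i j 1) p q‖ ≤ η) (x : Bits n) :
    f x y = f x y' := by
  refine eq_of_encode_close hc hs hε hδ hεδ fun S R hS hR hSR s => le_trans ?_ hη
  have hY := (P.alice_isChannel x).isDensity_onFst
    ((isDensity_single s).adjoin P.resource_isDensity)
  have e : ∀ y, P.encode x y (Matrix.single s s 1) = onSnd _ (P.bob y)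
      (onFst _ (P.alice x) (Quantum.adjoin (Fin 2) P.resource (Matrix.single s s 1))) :=
    fun y => onFst_onSnd_comm _ _ _
  rw [e, e]
  exact norm_trace_mul_onSnd_le h hS hR hSR hY

end CDQSProtocol

end Quantum

/-! ### One-way protocols from rounded channels. -/

/-- If the sender's input is classified in such a way that the class determines the function of the
receiver's input, then it suffices to send the class. -/
lemma oneWayAB_le_of_classifier {n m : ℕ} {f : Bits n → Bits n → Bool} {α : Type*} [Fintype α]
    (hα : Fintype.card α ≤ 2 ^ m) (c : Bits n → α)
    (hc : ∀ x x', c x = c x' → ∀ y, f x y = f x' y) : oneWayAB 0 f ≤ m := by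
  classical
  obtain ⟨g⟩ : Nonempty (α ↪ Bits m) := Function.Embedding.nonempty_of_card_le (by simpa using hα)
  refine Nat.sInf_le ⟨⟨fun x => PMF.pure (g (c x)), fun y t => PMF.pure
    -- The receiver evaluates `f` at any representative of the class; the default is never reached.
    (if h : ∃ x, g (c x) = t then f h.choose y else false)⟩, fun x y => ?_⟩
  have h : ∃ x', g (c x') = g (c x) := ⟨x, rfl⟩
  have := hc _ _ (g.injective h.choose_spec) y
  simp only [PMF.pure_bind, dif_pos h, this]
  simp

lemma oneWayAB_eq_zero_of_const {n : ℕ} {f : Bits n → Bits n → Bool}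
    (hf : ∀ x y, f x y = false) : oneWayAB 0 f = 0 :=
  Nat.le_zero.1 <| oneWayAB_le_of_classifier (α := Unit) (by simp) (fun _ => ()) fun x x' _ y => by
    rw [hf, hf]

lemma abs_sub_le_of_floor_eq {N : ℕ} (hN : 0 < N) {u v : ℝ} (hu : -1 ≤ u) (hv : -1 ≤ v)
    (h : ⌊(u + 1) * N⌋₊ = ⌊(v + 1) * N⌋₊) : |u - v| ≤ 1 / N := by
  have hN' : (0 : ℝ) < N := by exact_mod_cast hN
  have hu1 := Nat.floor_le (show 0 ≤ (u + 1) * N by apply mul_nonneg <;> linarith)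
  have hv1 := Nat.floor_le (show 0 ≤ (v + 1) * N by apply mul_nonneg <;> linarith)
  have hu2 := Nat.lt_floor_add_one ((u + 1) * N)
  have hv2 := Nat.lt_floor_add_one ((v + 1) * N)
  rw [h] at hu1 hu2
  rw [abs_le, neg_le, le_div_iff₀ hN', le_div_iff₀ hN']
  constructor <;> nlinarith

namespace Quantum

/-- Channels are classified, up to an error, by the rounded entries of their matrices. -/
lemma exists_classifier {X a b : Type*} [Fintype a] [Fintype b] [DecidableEq a] [DecidableEq b]
    {Φ : X → Op a →ₗ[ℂ] Op b} (hΦ : ∀ x, IsChannel (Φ x)) {N s : ℕ} (hN : 0 < N)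
    (hs : 2 * N < 2 ^ s) :
    ∃ c : X → ((a × a) × (b × b)) × Bool → Fin (2 ^ s), ∀ x x', c x = c x' →
      ∀ i j p q, ‖(Φ x - Φ x') (Matrix.single i j 1) p q‖ ≤ 2 / N := by
  -- The Boolean index selects the real or the imaginary part.
  let r (x : X) (z : ((a × a) × (b × b)) × Bool) : ℝ :=
    let w := Φ x (Matrix.single z.1.1.1 z.1.1.2 1) z.1.2.1 z.1.2.2
    if z.2 then w.re else w.im
  have hr : ∀ x z, |r x z| ≤ 1 := by
    intro x z
    have h := (hΦ x).norm_apply_single_le_one z.1.1.1 z.1.1.2 z.1.2.1 z.1.2.2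
    rcases z with ⟨z, _ | _⟩
    · exact (Complex.abs_im_le_norm _).trans h
    · exact (Complex.abs_re_le_norm _).trans h
  have hlt : ∀ x z, ⌊(r x z + 1) * N⌋₊ < 2 ^ s := by
    intro x z
    refine lt_of_le_of_lt (Nat.floor_le_of_le ?_) hs
    push_cast
    have := (abs_le.1 (hr x z)).2
    gcongr
    linarith
  refine ⟨fun x z => ⟨⌊(r x z + 1) * N⌋₊, hlt x z⟩, fun x x' h i j p q => ?_⟩
  have key : ∀ t, |r x (((i, j), (p, q)), t) - r x' (((i, j), (p, q)), t)| ≤ 1 / N := fun t =>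
    abs_sub_le_of_floor_eq hN (abs_le.1 (hr _ _)).1 (abs_le.1 (hr _ _)).1
      (Fin.mk.inj (congrFun h (((i, j), (p, q)), t)))
  refine (Complex.norm_le_abs_re_add_abs_im _).trans ?_
  have h1 := key true
  have h2 := key false
  calc _ ≤ 1 / (N : ℝ) + 1 / N := add_le_add h1 h2
    _ = _ := by ring

lemma card_classes_eq {a b : Type*} [Fintype a] [Fintype b] [DecidableEq a] [DecidableEq b] {t : ℕ}
    (h : Fintype.card a * Fintype.card b = 2 ^ t) (s : ℕ) :
    Fintype.card (((a × a) × (b × b)) × Bool → Fin (2 ^ s)) = 2 ^ (2 * 4 ^ t * s) := by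
  have : Fintype.card a * Fintype.card a * (Fintype.card b * Fintype.card b) = 4 ^ t := by
    rw [mul_mul_mul_comm, h, ← mul_pow]; norm_num
  simp only [Fintype.card_fun, Fintype.card_fin, Fintype.card_prod, Fintype.card_bool, this]
  rw [← pow_mul]
  congr 1
  ring

lemma oneWayAB_le_of_channels {n t : ℕ} {f : Bits n → Bits n → Bool} {a b : Type*} [Fintype a]
    [Fintype b] [DecidableEq a] [DecidableEq b] (ht : Fintype.card a * Fintype.card b = 2 ^ t)
    {Φ : Bits n → Op a →ₗ[ℂ] Op b} (hΦ : ∀ x, IsChannel (Φ x))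
    (hf : ∀ η : ℝ, (Fintype.card a * Fintype.card b : ℝ) ^ 2 * η ≤ 1 / 4 → ∀ x x',
      (∀ i j p q, ‖(Φ x - Φ x') (Matrix.single i j 1) p q‖ ≤ η) → ∀ y, f x y = f x' y) :
    oneWayAB 0 f ≤ 2 * 4 ^ t * (2 * t + 5) := by
  have h4 : (4 : ℕ) ^ t = 2 ^ (2 * t) := by rw [pow_mul]; norm_num
  -- The entrywise error `2 / N = 1 / (4 * 4 ^ t)`, times the factor `4 ^ t`, is exactly 1/4; `2 * N
  -- = 2 ^ (2 * t + 4)` fits below `2 ^ s`.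
  obtain ⟨c, hc⟩ := exists_classifier hΦ (N := 8 * 4 ^ t) (s := 2 * t + 5) (by positivity) (by
    rw [h4, pow_add]
    have := Nat.pos_of_ne_zero (pow_ne_zero (2 * t) (two_ne_zero (α := ℕ)))
    omega)
  refine oneWayAB_le_of_classifier (card_classes_eq ht _).le c fun x x' h => hf _ ?_ x x' (hc x x' h)
  have : (Fintype.card a * Fintype.card b : ℝ) = 2 ^ t := by exact_mod_cast ht
  rw [this, ← pow_mul, mul_comm t, pow_mul]
  have h0 : (4 : ℝ) ^ t ≠ 0 := by positivity
  push_cast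
  norm_num
  field_simp
  norm_num

namespace CDQSProtocol

variable {n E qA qB : ℕ} {P : CDQSProtocol n E qA qB} {f : Bits n → Bits n → Bool} {ε δ : ℝ}

lemma oneWayAB_le (hc : P.IsCorrect f ε) (hs : P.IsSecure f δ) (hε : 0 ≤ ε) (hδ : 0 ≤ δ)
    -- The extra 1 in `t` is the secret qubit, part of Alice's input; 56 is `2 * 4 * 7`.
    (hεδ : ε + δ < 3 / 4) : oneWayAB 0 f ≤ 56 * 4 ^ (E + qA) * (1 + qA + E) := by
  refine (oneWayAB_le_of_channels (t := E + qA + 1) ?_ P.alice_isChannel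
    fun η hη x x' h y => eq_of_alice_close hc hs hε hδ hεδ hη h y).trans ?_
  · simp; ring
  · rw [pow_succ]
    nlinarith [Nat.zero_le (4 ^ (E + qA) * (E + qA))]

lemma oneWayBA_le (hc : P.IsCorrect f ε) (hs : P.IsSecure f δ) (hε : 0 ≤ ε) (hδ : 0 ≤ δ)
    (hεδ : ε + δ < 3 / 4) : oneWayBA 0 f ≤ 56 * 4 ^ (E + qB) * (1 + qB + E) := by
  refine (oneWayAB_le_of_channels (t := E + qB) ?_ P.bob_isChannel
    fun η hη y y' h x => eq_of_bob_close hc hs hε hδ hεδ hη h x).trans ?_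
  · simp; ring
  · nlinarith [Nat.zero_le (4 ^ (E + qB) * (E + qB)), Nat.zero_le (4 ^ (E + qB))]

end CDQSProtocol

end Quantum

/-! ### Logarithms and the final constant. -/

lemma logb_natCast_le {r E q : ℕ} (h : r ≤ 56 * 4 ^ (E + q) * (1 + q + E)) :
    Real.logb 2 r ≤ 6 + 2 * (E + q) + Real.logb 2 (1 + q + E) := by
  have h1 : (0 : ℝ) ≤ Real.logb 2 (1 + q + E) :=
    Real.logb_nonneg one_lt_two (by linarith [q.cast_nonneg (α := ℝ), E.cast_nonneg (α := ℝ)])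
  rcases Nat.eq_zero_or_pos r with rfl | hr
  · simp only [Nat.cast_zero, Real.logb_zero]
    positivity
  · have h2 : (r : ℝ) ≤ 2 ^ (6 + 2 * (E + q)) * (1 + q + E) := by
      have h3 : r ≤ 2 ^ (6 + 2 * (E + q)) * (1 + q + E) := h.trans <| by
        rw [pow_add 2, pow_mul]; gcongr <;> norm_num
      exact_mod_cast h3
    have hpos : (0 : ℝ) < 1 + q + E := by positivity
    refine (Real.logb_le_logb_of_le one_lt_two (by exact_mod_cast hr) h2).trans_eq ?_
    rw [Real.logb_mul (by positivity) hpos.ne', Real.logb_pow, Real.logb_self_eq_one one_lt_two]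
    push_cast
    ring

theorem mainTheorem2 (ε δ : ℝ) (hε : 0 ≤ ε) (hδ : 0 ≤ δ) (hεδ : ε + δ < 2 * (1 - 1 / √2)) :
    ∃ C : ℝ, 0 < C ∧
      ∀ (n E qA qB : ℕ) (f : Bits n → Bits n → Bool) (P : Quantum.CDQSProtocol n E qA qB),
        P.IsCorrect f ε → P.IsSecure f δ →
          (1 / 2 : ℝ) * (Real.logb 2 (oneWayBA 0 f) + Real.logb 2 (oneWayAB 0 f))
              - C * (Real.logb 2 (1 + qA + E) + Real.logb 2 (1 + qB + E))
            ≤ 2 * E + qA + qB := by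
  have hsum : ε + δ < 3 / 4 := by
    have h2 : √2 < 8 / 5 := by
      rw [Real.sqrt_lt' (by norm_num)]; norm_num
    have h3 : 5 / 8 < 1 / √2 := by
      rw [lt_div_iff₀ (by positivity)]; linarith
    linarith
  -- The averaged bounds leave an excess of 6 plus half the sum of the logarithms; 7 suffices once
  -- that sum is at least 1.
  refine ⟨7, by norm_num, fun n E qA qB f P hc hs => ?_⟩
  -- Here both logarithms on the correction side vanish and absorb nothing, but `f` is constantly
  -- false and `log 0 = 0`.
  by_cases h0 : qA + qB + E = 0
  · obtain ⟨rfl, rfl, rfl⟩ : qA = 0 ∧ qB = 0 ∧ E = 0 := by omega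
    have hf := hc.eq_false_of_empty hε (by linarith)
    rw [oneWayBA, oneWayAB_eq_zero_of_const hf, oneWayAB_eq_zero_of_const fun y x => hf x y]
    simp
  · have hA := logb_natCast_le (Quantum.CDQSProtocol.oneWayAB_le hc hs hε hδ hsum)
    have hB := logb_natCast_le (Quantum.CDQSProtocol.oneWayBA_le hc hs hε hδ hsum)
    have hlog : (1 : ℝ) ≤ Real.logb 2 (1 + qA + E) + Real.logb 2 (1 + qB + E) := by
      have h1 : (0 : ℝ) < 1 + qA + E := by positivity
      have h2 : (0 : ℝ) < 1 + qB + E := by positivity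
      rw [← Real.logb_mul h1.ne' h2.ne', Real.le_logb_iff_rpow_le one_lt_two (by positivity),
        Real.rpow_one]
      have : 2 ≤ (1 + qA + E) * (1 + qB + E) := by
        have : 1 ≤ qA + qB + E := Nat.one_le_iff_ne_zero.2 h0
        nlinarith [Nat.zero_le (qA * qB), Nat.zero_le (qA * E), Nat.zero_le (E * qB),
          Nat.zero_le (E * E)]
      exact_mod_cast this
    linarith
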